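/- Let $\{X_j(t),\ t\in[0,1]\}$, $j=1,2,\dots$, be mutually uncorrelated (jointly measurable) zero-mean, square-integrable real random processes on one probability space, all with the same continuous covariance function $\mathcal K(t,s)$, $t,s\in[0,1]$. For $d\in\mathbb N=\{1,2,\dots\}$ and $t\in[0,1]^d$ put $$Y_d(t)=\sum_{j=1}^d X_j(t_j),\qquad Z_d(t)=Y_d(t)-\int_{[0,1]^d}Y_d(s)\,ds .$$ Let $\langle\cdot,\cdot\rangle_{2,d}$ and $\|\cdot\|_{2,d}$ be the scalar product and the norm of $L_2([0,1]^d)$. For a random field $V$ on $[0,1]^d$ with $\mathbb E\|V\|_{2,d}^2<\infty$ put $e^V(0)=(\mathbb E\|V\|_{2,d}^2)^{1/2}$ and, for $n\in\mathbb N$, $$e^V(n)=\inf\Bigl\{\Bigl(\mathbb E\Bigl\|V-\sum_{m=1}^n\langle V,\psi_m\rangle_{2,d}\,\psi_m\Bigr\|_{2,d}^2\Bigr)^{1/2}:\ \psi_1,\dots,\psi_n\in L_2([0,1]^d)\Bigr\},$$ and, for $\varepsilon>0$, let $$n^V(\varepsilon)=\min\{n\in\mathbb N:\ e^V(n)\le\varepsilon\,e^V(0)\}$$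 be the average case approximation complexity. Let $\Lambda$ be the trace of the covariance operator $f\mapsto\int_{[0,1]}\mathcal K(\cdot,s)f(s)\,ds$ on $L_2([0,1])$, let $$\bar\Lambda=\int_{[0,1]}\mathcal K(s,s)\,ds-\iint_{[0,1]^2}\mathcal K(t,s)\,dt\,ds ,$$ and suppose that $\bar\Lambda\neq0$ (then $\Lambda>0$). Put $\varepsilon_0=(\bar\Lambda/\Lambda)^{1/2}$. Then for every $\varepsilon\in(0,\varepsilon_0)$ and every $d\in\mathbb N$ the minima below exist and $$n^{Z_d}\bigl(\varepsilon/\varepsilon_0+d^{-1/2}\bigr)-1\ \le\ n^{Y_d}(\varepsilon)\ \le\ n^{Z_d}\bigl(\varepsilon/\varepsilon_0\bigr)+1 .$$ -/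

import Mathlib

open MeasureTheory ProbabilityTheory
open scoped ENNReal

namespace AdditiveField

noncomputable section

/-- The unit cube `[0,1]^d`, carrying Lebesgue measure (its `volume`). -/
abbrev Cube (d : ℕ) : Type := Fin d → unitInterval

/-- `(E ‖V‖²_{2,d})^{1/2}` for a random field `V` on `[0,1]^d`, as an extended non-negative real. -/
def rms {Ω : Type*} [MeasurableSpace Ω] (P : Measure Ω) {d : ℕ} (V : Ω → Cube d → ℝ) : ℝ≥0∞ :=
  (∫⁻ ω, eLpNorm (V ω) 2 volume ^ 2 ∂P) ^ (1 / 2 : ℝ)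

/-- The field `∑_{m=1}^n ⟨V, ψ_m⟩_{2,d} ψ_m` of rank at most `n`. -/
def rankApprox {Ω : Type*} {d n : ℕ} (V : Ω → Cube d → ℝ)
    (ψ : Fin n → Lp ℝ 2 (volume : Measure (Cube d))) : Ω → Cube d → ℝ :=
  fun ω t => ∑ m, (∫ s, V ω s * ψ m s) * ψ m t

/-- The smallest 2-average error `e^V(n)` among the approximations
`∑_{m=1}^n ⟨V, ψ_m⟩_{2,d} ψ_m`, with arbitrary `ψ_1, …, ψ_n ∈ L_2([0,1]^d)`. -/
def minError {Ω : Type*} [MeasurableSpace Ω] (P : Measure Ω) {d : ℕ} (V : Ω → Cube d → ℝ)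
    (n : ℕ) : ℝ≥0∞ :=
  ⨅ ψ : Fin n → Lp ℝ 2 (volume : Measure (Cube d)),
    rms P (fun ω t => V ω t - rankApprox V ψ ω t)

/-- The positive integers `n` with `e^V(n) ≤ ε e^V(0)`, where `e^V(0) = (E ‖V‖²_{2,d})^{1/2}`. -/
def admissibleRanks {Ω : Type*} [MeasurableSpace Ω] (P : Measure Ω) {d : ℕ}
    (V : Ω → Cube d → ℝ) (ε : ℝ) : Set ℕ :=
  {n | 1 ≤ n ∧ minError P V n ≤ ENNReal.ofReal ε * rms P V}

/-- The average case approximation complexity `n^V(ε)`: the least admissible rank. -/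
def complexity {Ω : Type*} [MeasurableSpace Ω] (P : Measure Ω) {d : ℕ}
    (V : Ω → Cube d → ℝ) (ε : ℝ) : ℕ :=
  sInf (admissibleRanks P V ε)

/-- The additive field `Y_d(t) = ∑_j X_j(t_j)`; the processes are numbered from `0`. -/
def fieldY {Ω : Type*} (X : ℕ → unitInterval → Ω → ℝ) (d : ℕ) : Ω → Cube d → ℝ :=
  fun ω t => ∑ j : Fin d, X j (t j) ω

/-- The centred field `Z_d(t) = Y_d(t) - ∫_{[0,1]^d} Y_d(s) ds`. -/
def fieldZ {Ω : Type*} (X : ℕ → unitInterval → Ω → ℝ) (d : ℕ) : Ω → Cube d → ℝ :=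
  fun ω t => fieldY X d ω t - ∫ s, fieldY X d ω s

/-- The integral operator `(K f)(t) = ∫_{[0,1]} K(t,s) f(s) ds`. -/
def covOp (K : unitInterval → unitInterval → ℝ) (f : unitInterval → ℝ) : unitInterval → ℝ :=
  fun t => ∫ s, K t s * f s

/-- The trace `Λ = ∑_i ⟨K e_i, e_i⟩` of the covariance operator, computed in an orthonormal basis
`(e_i)` of `L_2([0,1])`. In a basis of eigenvectors this is the sum of the eigenvalues. -/
def trace {ι : Type*} (K : unitInterval → unitInterval → ℝ)
    (e : HilbertBasis ι ℝ (Lp ℝ 2 (volume : Measure unitInterval))) : ℝ :=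
  ∑' i, ∫ t, covOp K (e i) t * e i t

/-- `Λ̄ = ∫ K(s,s) ds - ∬ K(t,s) dt ds`. -/
def traceBar (K : unitInterval → unitInterval → ℝ) : ℝ :=
  (∫ s, K s s) - ∫ t, ∫ s, K t s

/-- `ε₀ = (Λ̄ / Λ)^{1/2}`. -/
def epsZero {ι : Type*} (K : unitInterval → unitInterval → ℝ)
    (e : HilbertBasis ι ℝ (Lp ℝ 2 (volume : Measure unitInterval))) : ℝ :=
  Real.sqrt (traceBar K / trace K e)

end

end AdditiveField

/-!
The fields `Y_d` and `Z_d` differ by a random multiple of the constant function `1`. Replacing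
`ψ_1, …, ψ_n` by an orthonormal basis of the span of `1, ψ_1, …, ψ_n` turns an approximation of
either field into one of the other, which has one more term and an error that is not larger, because
an orthogonal projection is the best approximation. Moreover the two thresholds agree,
`(ε / ε₀) e^Z(0) = ε e^Y(0)`: by Fubini and the vanishing correlations `e^Y(0)² = d Λ` and
`e^Z(0)² = d Λ̄`. Hence `n^Y(ε)` and `n^Z(ε / ε₀)` differ by at most one, and adding `d^{-1/2}`
to the argument of the non-increasing function `n^Z` can only lower its value. The minima exist
because Parseval's identity, integrated over the probability space, makes the errors tend to zero.
-/

namespace AdditiveField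

section Hilbert

variable {𝕜 H : Type*} [RCLike 𝕜] [NormedAddCommGroup H] [InnerProductSpace 𝕜 H]

lemma exists_sum_inner_smul_eq_starProjection (W : Submodule 𝕜 H) [FiniteDimensional 𝕜 W] {n : ℕ}
    (hW : Module.finrank 𝕜 W ≤ n) :
    ∃ φ : Fin n → H, ∀ x, ∑ m, inner 𝕜 (φ m) x • φ m = W.starProjection x := by
  let b := stdOrthonormalBasis 𝕜 W
  have hinj := Fin.castLE_injective hW
  refine ⟨Function.extend (Fin.castLE hW) (fun i => (b i : H)) 0, fun x => ?_⟩
  have hsum : W.starProjection x = ∑ i, inner 𝕜 (b i : H) x • (b i : H) := by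
    simp [b.starProjection_eq_sum_rankOne]
  rw [hsum]
  refine (Finset.sum_of_injOn (Fin.castLE hW) hinj.injOn (by simp) (fun m _ hm => ?_)
    fun i _ => ?_).symm
  · rw [Function.extend_apply' _ _ _ fun ⟨i, hi⟩ => hm ⟨i, by simp, hi⟩, Pi.zero_apply, smul_zero]
  · rw [hinj.extend_apply]

lemma exists_norm_add_smul_sub_sum_le {n : ℕ} (ψ : Fin n → H) (u : H) :
    ∃ φ : Fin (n + 1) → H, ∀ (x : H) (c : 𝕜),
      ‖x + c • u - ∑ m, inner 𝕜 (φ m) (x + c • u) • φ m‖ ≤ ‖x - ∑ m, inner 𝕜 (ψ m) x • ψ m‖ := by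
  let v : Fin (n + 1) → H := Fin.cons u ψ
  let W := Submodule.span 𝕜 (Set.range v)
  have hW : Module.finrank 𝕜 W ≤ n + 1 :=
    (finrank_range_le_card v).trans_eq (Fintype.card_fin _)
  have : FiniteDimensional 𝕜 W := FiniteDimensional.span_of_finite 𝕜 (Set.finite_range v)
  obtain ⟨φ, hφ⟩ := exists_sum_inner_smul_eq_starProjection W hW
  refine ⟨φ, fun x c => ?_⟩
  have hu : u ∈ W := Submodule.subset_span ⟨0, rfl⟩
  have hψ : ∀ m, ψ m ∈ W := fun m => Submodule.subset_span ⟨m.succ, rfl⟩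
  let w : W := ⟨c • u + ∑ m, inner 𝕜 (ψ m) x • ψ m,
    W.add_mem (W.smul_mem _ hu) (W.sum_mem fun m _ => W.smul_mem _ (hψ m))⟩
  calc ‖x + c • u - ∑ m, inner 𝕜 (φ m) (x + c • u) • φ m‖
      = ⨅ w : W, ‖x + c • u - w‖ := by rw [hφ, Submodule.starProjection_minimal]
    _ ≤ ‖x + c • u - w‖ := ciInf_le ⟨0, Set.forall_mem_range.2 fun _ => norm_nonneg _⟩ w
    _ = ‖x - ∑ m, inner 𝕜 (ψ m) x • ψ m‖ := by
      rw [add_comm x, add_sub_add_left_eq_sub]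

lemma norm_sub_sum_inner_smul_sq {κ : Type*} [Fintype κ] {b : κ → H} (hb : Orthonormal 𝕜 b)
    (x : H) :
    ‖x - ∑ i, inner 𝕜 (b i) x • b i‖ ^ 2 = ‖x‖ ^ 2 - ∑ i, ‖inner 𝕜 (b i) x‖ ^ 2 := by
  have hcross : inner 𝕜 x (∑ i, inner 𝕜 (b i) x • b i) = ∑ i, (‖inner 𝕜 (b i) x‖ ^ 2 : 𝕜) := by
    simp only [inner_sum, inner_smul_right]
    refine Finset.sum_congr rfl fun i _ => ?_
    rw [← inner_conj_symm x (b i), RCLike.mul_conj]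
  have hself : inner 𝕜 (∑ i, inner 𝕜 (b i) x • b i) (∑ i, inner 𝕜 (b i) x • b i)
      = ∑ i, (‖inner 𝕜 (b i) x‖ ^ 2 : 𝕜) := by
    simp only [hb.inner_sum, RCLike.conj_mul]
  rw [@norm_sub_sq 𝕜, hcross, @norm_sq_eq_re_inner 𝕜 _ _ _ _ (∑ i, _), hself]
  norm_cast
  ring

lemma countable_of_orthonormal [TopologicalSpace.SeparableSpace H] {ι : Type*} {b : ι → H}
    (hb : Orthonormal 𝕜 b) : Countable ι := by
  refine Pairwise.countable_of_isOpen_disjoint (s := fun i => Metric.ball (b i) (1 / 2))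
    (fun i j hij => Metric.ball_disjoint_ball ?_) (fun _ => Metric.isOpen_ball)
    fun i => ⟨b i, by simp⟩
  have hdist : ‖b i - b j‖ ^ 2 = 2 := by
    rw [@norm_sub_sq 𝕜, hb.1, hb.1, hb.2 hij, map_zero]
    norm_num
  rw [dist_eq_norm]
  nlinarith [norm_nonneg (b i - b j)]

lemma hasSum_norm_inner_sq {ι : Type*} (b : HilbertBasis ι 𝕜 H) (x : H) :
    HasSum (fun i => ‖inner 𝕜 (b i) x‖ ^ 2) (‖x‖ ^ 2) := by
  have hparseval := b.hasSum_inner_mul_inner x x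
  simp only [← inner_conj_symm x (b _), RCLike.conj_mul, inner_self_eq_norm_sq_to_K] at hparseval
  exact_mod_cast hparseval

end Hilbert

section L2

variable {α : Type*} [MeasurableSpace α] {μ : Measure α} {f g : α → ℝ}

lemma inner_toLp_toLp (hf : MemLp f 2 μ) (hg : MemLp g 2 μ) :
    inner ℝ (hg.toLp g) (hf.toLp f) = ∫ t, f t * g t ∂μ := by
  rw [L2.inner_def]
  refine integral_congr_ae ?_
  filter_upwards [hf.coeFn_toLp, hg.coeFn_toLp] with t htf htg
  simp [htf, htg]

lemma inner_toLp (hf : MemLp f 2 μ) (ψ : Lp ℝ 2 μ) :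
    inner ℝ ψ (hf.toLp f) = ∫ t, f t * ψ t ∂μ := by
  rw [← inner_toLp_toLp hf (Lp.memLp ψ), Lp.toLp_coeFn]

lemma norm_toLp_sq (hf : MemLp f 2 μ) : ‖hf.toLp f‖ ^ 2 = ∫ t, f t ^ 2 ∂μ := by
  rw [← real_inner_self_eq_norm_sq, inner_toLp_toLp hf hf]
  simp only [sq]

lemma sq_integral_mul_le (hf : MemLp f 2 μ) (hg : MemLp g 2 μ) :
    (∫ t, f t * g t ∂μ) ^ 2 ≤ (∫ t, f t ^ 2 ∂μ) * ∫ t, g t ^ 2 ∂μ := by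
  rw [← inner_toLp_toLp hf hg, ← norm_toLp_sq hf, ← norm_toLp_sq hg, mul_comm, ← mul_pow, ← sq_abs]
  gcongr
  exact abs_real_inner_le_norm _ _

lemma eLpNorm_two_sq (hf : MemLp f 2 μ) :
    eLpNorm f 2 μ ^ 2 = ENNReal.ofReal (∫ t, f t ^ 2 ∂μ) := by
  rw [← norm_toLp_sq hf, Lp.norm_toLp, ENNReal.ofReal_pow ENNReal.toReal_nonneg,
    ENNReal.ofReal_toReal hf.2.ne]

variable {κ : Type*} [Fintype κ] {ψ : κ → Lp ℝ 2 μ}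

lemma eLpNorm_sub_sum_integral_mul (hf : MemLp f 2 μ) (ψ : κ → Lp ℝ 2 μ) :
    eLpNorm (fun t => f t - ∑ m, (∫ s, f s * ψ m s ∂μ) * ψ m t) 2 μ
      = ‖hf.toLp f - ∑ m, inner ℝ (ψ m) (hf.toLp f) • ψ m‖ₑ := by
  rw [Lp.enorm_def]
  refine eLpNorm_congr_ae ?_
  have hsmul : ∀ᵐ t ∂μ, ∀ m, (inner ℝ (ψ m) (hf.toLp f) • ψ m : Lp ℝ 2 μ) t
      = inner ℝ (ψ m) (hf.toLp f) * ψ m t :=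
    ae_all_iff.2 fun m => Lp.coeFn_smul _ (ψ m)
  filter_upwards [hf.coeFn_toLp, hsmul,
    Lp.coeFn_sub (hf.toLp f) (∑ m, inner ℝ (ψ m) (hf.toLp f) • ψ m),
    Lp.coeFn_finsetSum Finset.univ fun m => inner ℝ (ψ m) (hf.toLp f) • ψ m]
    with t htf htsmul htsub htsum
  rw [htsub, Pi.sub_apply, htf, htsum, Finset.sum_apply]
  simp only [↓htsmul, inner_toLp]

lemma eLpNorm_sub_sum_integral_mul_sq (hf : MemLp f 2 μ) (hψ : Orthonormal ℝ ψ) :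
    eLpNorm (fun t => f t - ∑ m, (∫ s, f s * ψ m s ∂μ) * ψ m t) 2 μ ^ 2
      = ENNReal.ofReal (∫ t, f t ^ 2 ∂μ - ∑ m, (∫ t, f t * ψ m t ∂μ) ^ 2) := by
  rw [eLpNorm_sub_sum_integral_mul hf, ← ofReal_norm, ← ENNReal.ofReal_pow (norm_nonneg _),
    norm_sub_sum_inner_smul_sq hψ, norm_toLp_sq]
  simp only [inner_toLp, Real.norm_eq_abs, sq_abs]

lemma sum_sq_integral_mul_le (hf : MemLp f 2 μ) (hψ : Orthonormal ℝ ψ) :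
    ∑ m, (∫ t, f t * ψ m t ∂μ) ^ 2 ≤ ∫ t, f t ^ 2 ∂μ := by
  simpa only [inner_toLp, norm_toLp_sq, Real.norm_eq_abs, sq_abs] using
    hψ.sum_inner_products_le (hf.toLp f) (s := Finset.univ)

end L2

section SecondOrder

variable {Ω α : Type*} [MeasurableSpace Ω] [MeasurableSpace α]

/-- The mean energy `E ‖V‖²` of a random field `V`, as a real number; it is used for fields that
are square-integrable on the product space, so that the Bochner integrals carry no junk value. -/
noncomputable def meanSq (P : Measure Ω) (μ : Measure α) (V : Ω → α → ℝ) : ℝ :=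
  ∫ ω, ∫ t, V ω t ^ 2 ∂μ ∂P

/-- The second-moment kernel `(t, s) ↦ E V(t) V(s)` of a random field `V`, which is its covariance
function if `V` has mean zero. -/
noncomputable def secondMoment (P : Measure Ω) (V : Ω → α → ℝ) (t s : α) : ℝ :=
  ∫ ω, V ω t * V ω s ∂P

/-- The field `V - ∫ V` obtained by subtracting from each path its average over the index space,
as in the passage from `Y_d` to `Z_d`. -/
noncomputable def center (μ : Measure α) (V : Ω → α → ℝ) : Ω → α → ℝ :=
  fun ω t => V ω t - ∫ s, V ω s ∂μ

variable {P : Measure Ω} {μ : Measure α} {V : Ω → α → ℝ} {g : α → ℝ}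

lemma meanSq_nonneg (P : Measure Ω) (μ : Measure α) (V : Ω → α → ℝ) : 0 ≤ meanSq P μ V :=
  integral_nonneg fun _ => integral_nonneg fun _ => sq_nonneg _

section SFinite

variable [SFinite μ]

lemma integrable_integral_sq (hV : MemLp (Function.uncurry V) 2 (P.prod μ)) :
    Integrable (fun ω => ∫ t, V ω t ^ 2 ∂μ) P :=
  hV.integrable_sq.integral_prod_left

variable [SFinite P]

lemma ae_memLp_of_memLp_uncurry (hV : MemLp (Function.uncurry V) 2 (P.prod μ)) :
    ∀ᵐ ω ∂P, MemLp (V ω) 2 μ := by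
  filter_upwards [hV.1.prodMk_left, hV.integrable_sq.prod_right_ae] with ω hmeas hsq
  exact (memLp_two_iff_integrable_sq hmeas).2 hsq

lemma lintegral_eLpNorm_sq (hV : MemLp (Function.uncurry V) 2 (P.prod μ)) :
    ∫⁻ ω, eLpNorm (V ω) 2 μ ^ 2 ∂P = ENNReal.ofReal (meanSq P μ V) := by
  rw [meanSq, ofReal_integral_eq_lintegral_ofReal (integrable_integral_sq hV)
    (.of_forall fun ω => integral_nonneg fun t => sq_nonneg _)]
  refine lintegral_congr_ae ?_
  filter_upwards [ae_memLp_of_memLp_uncurry hV] with ω hω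
  exact eLpNorm_two_sq hω

lemma memLp_integral_mul (hV : MemLp (Function.uncurry V) 2 (P.prod μ)) (hg : MemLp g 2 μ) :
    MemLp (fun ω => ∫ t, V ω t * g t ∂μ) 2 P := by
  have hmeas : AEStronglyMeasurable (fun ω => ∫ t, V ω t * g t ∂μ) P :=
    (hV.1.mul hg.1.comp_snd).integral_prod_right'
  refine (memLp_two_iff_integrable_sq hmeas).2 <|
    ((integrable_integral_sq hV).mul_const (∫ t, g t ^ 2 ∂μ)).mono' (hmeas.pow 2) ?_
  filter_upwards [ae_memLp_of_memLp_uncurry hV] with ω hω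
  rw [Real.norm_of_nonneg (sq_nonneg _)]
  exact sq_integral_mul_le hω hg

lemma lintegral_eLpNorm_sub_sum_sq (hV : MemLp (Function.uncurry V) 2 (P.prod μ)) {κ : Type*}
    [Fintype κ] {ψ : κ → Lp ℝ 2 μ} (hψ : Orthonormal ℝ ψ) :
    ∫⁻ ω, eLpNorm (fun t => V ω t - ∑ m, (∫ s, V ω s * ψ m s ∂μ) * ψ m t) 2 μ ^ 2 ∂P
      = ENNReal.ofReal (meanSq P μ V - ∑ m, ∫ ω, (∫ t, V ω t * ψ m t ∂μ) ^ 2 ∂P) := by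
  have hcoeff : ∀ m, Integrable (fun ω => (∫ t, V ω t * ψ m t ∂μ) ^ 2) P :=
    fun m => (memLp_integral_mul hV (Lp.memLp (ψ m))).integrable_sq
  have hsum := integrable_finsetSum Finset.univ fun m _ => hcoeff m
  rw [meanSq, ← integral_finsetSum _ fun m _ => hcoeff m,
    ← integral_sub (integrable_integral_sq hV) hsum,
    ofReal_integral_eq_lintegral_ofReal]
  · refine lintegral_congr_ae ?_
    filter_upwards [ae_memLp_of_memLp_uncurry hV] with ω hω
    exact eLpNorm_sub_sum_integral_mul_sq hω hψ
  · exact (integrable_integral_sq hV).sub hsum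
  · filter_upwards [ae_memLp_of_memLp_uncurry hV] with ω hω
    exact sub_nonneg.2 (sum_sq_integral_mul_le hω hψ)

lemma hasSum_integral_sq_integral_mul [IsSeparable μ]
    (hV : MemLp (Function.uncurry V) 2 (P.prod μ)) {ι : Type*} (b : HilbertBasis ι ℝ (Lp ℝ 2 μ)) :
    HasSum (fun i => ∫ ω, (∫ t, V ω t * b i t ∂μ) ^ 2 ∂P) (meanSq P μ V) := by
  -- A separability instance for `Lp ℝ 2 μ` is found only with this fact.
  have : Fact ((2 : ℝ≥0∞) ≠ ∞) := ⟨ENNReal.ofNat_ne_top⟩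
  have := countable_of_orthonormal b.orthonormal
  have hparseval : ∀ᵐ ω ∂P,
      HasSum (fun i => (∫ t, V ω t * b i t ∂μ) ^ 2) (∫ t, V ω t ^ 2 ∂μ) := by
    filter_upwards [ae_memLp_of_memLp_uncurry hV] with ω hω
    simpa only [inner_toLp, norm_toLp_sq, Real.norm_eq_abs, sq_abs] using
      hasSum_norm_inner_sq b (hω.toLp _)
  -- The terms are non-negative, so they are their own dominating functions.
  refine hasSum_integral_of_dominated_convergence (fun i ω => (∫ t, V ω t * b i t ∂μ) ^ 2)
    (fun i => (memLp_integral_mul hV (Lp.memLp (b i))).1.pow 2)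
    (fun i => .of_forall fun ω => (Real.norm_of_nonneg (sq_nonneg _)).le)
    (hparseval.mono fun ω h => h.summable) ?_ hparseval
  exact (integrable_integral_sq hV).congr (hparseval.mono fun ω h => h.tsum_eq.symm)

lemma integrable_mul_mul_mul (hV : MemLp (Function.uncurry V) 2 (P.prod μ)) (hg : MemLp g 2 μ) :
    Integrable (fun z : Ω × α × α => V z.1 z.2.1 * g z.2.1 * (V z.1 z.2.2 * g z.2.2))
      (P.prod (μ.prod μ)) := by
  have hfst : MemLp (fun z : Ω × α × α => V z.1 z.2.1 * g z.2.2) 2 (P.prod (μ.prod μ)) := by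
    have h : MemLp (fun z : (Ω × α) × α => V z.1.1 z.1.2 * g z.2) 2 ((P.prod μ).prod μ) := by
      refine (memLp_two_iff_integrable_sq (hV.1.comp_fst.mul hg.1.comp_snd)).2 ?_
      exact (hV.integrable_sq.mul_prod hg.integrable_sq).congr
        (.of_forall fun z => (mul_pow _ _ _).symm)
    exact h.comp_measurePreserving (measurePreserving_prodAssoc P μ μ).symm
  have hsnd : MemLp (fun z : Ω × α × α => V z.1 z.2.2 * g z.2.1) 2 (P.prod (μ.prod μ)) :=
    hfst.comp_measurePreserving ((MeasurePreserving.id P).prod Measure.measurePreserving_swap)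
  refine (hfst.integrable_mul hsnd).congr (.of_forall fun z => ?_)
  simp only [Pi.mul_apply]
  ring

lemma integral_sq_integral_mul (hV : MemLp (Function.uncurry V) 2 (P.prod μ)) (hg : MemLp g 2 μ) :
    ∫ ω, (∫ t, V ω t * g t ∂μ) ^ 2 ∂P = ∫ t, (∫ s, secondMoment P V t s * g s ∂μ) * g t ∂μ := by
  have hint := integrable_mul_mul_mul hV hg
  calc ∫ ω, (∫ t, V ω t * g t ∂μ) ^ 2 ∂P
      = ∫ ω, ∫ z : α × α, V ω z.1 * g z.1 * (V ω z.2 * g z.2) ∂(μ.prod μ) ∂P :=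
        integral_congr_ae (.of_forall fun ω => (sq _).trans (integral_prod_mul _ _).symm)
    _ = ∫ z : α × α, ∫ ω, V ω z.1 * g z.1 * (V ω z.2 * g z.2) ∂P ∂(μ.prod μ) :=
        integral_integral_swap hint
    _ = ∫ t, ∫ s, ∫ ω, V ω t * g t * (V ω s * g s) ∂P ∂μ ∂μ :=
        integral_prod _ hint.integral_prod_right
    _ = ∫ t, (∫ s, secondMoment P V t s * g s ∂μ) * g t ∂μ := by
        simp only [secondMoment, ← integral_mul_const]
        congr! 6
        ring

lemma meanSq_eq_integral_secondMoment (hV : MemLp (Function.uncurry V) 2 (P.prod μ)) :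
    meanSq P μ V = ∫ t, secondMoment P V t t ∂μ := by
  simp only [meanSq, secondMoment, ← sq]
  exact integral_integral_swap (f := fun ω t => V ω t ^ 2) hV.integrable_sq

lemma memLp_uncurry_of_integrable_secondMoment
    (hmeas : AEStronglyMeasurable (Function.uncurry V) (P.prod μ))
    (hL2 : ∀ t, MemLp (fun ω => V ω t) 2 P) (hint : Integrable (fun t => secondMoment P V t t) μ) :
    MemLp (Function.uncurry V) 2 (P.prod μ) := by
  refine (memLp_two_iff_integrable_sq hmeas).2 ((integrable_prod_iff' (hmeas.pow 2)).2
    ⟨.of_forall fun t => (hL2 t).integrable_sq, ?_⟩)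
  simpa only [Function.uncurry_apply_pair, Pi.pow_apply, norm_pow, Real.norm_eq_abs, sq_abs,
    secondMoment, ← sq] using hint

end SFinite

section FiniteMeasure

variable [SFinite P] [IsFiniteMeasure μ]

lemma memLp_integral (hV : MemLp (Function.uncurry V) 2 (P.prod μ)) :
    MemLp (fun ω => ∫ t, V ω t ∂μ) 2 P := by
  simpa only [mul_one] using memLp_integral_mul hV (memLp_const 1)

lemma memLp_center (hV : MemLp (Function.uncurry V) 2 (P.prod μ)) :
    MemLp (Function.uncurry (center μ V)) 2 (P.prod μ) :=
  hV.sub ((memLp_integral hV).comp_fst μ)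

lemma integral_sq_integral (hV : MemLp (Function.uncurry V) 2 (P.prod μ)) :
    ∫ ω, (∫ t, V ω t ∂μ) ^ 2 ∂P = ∫ t, ∫ s, secondMoment P V t s ∂μ ∂μ := by
  simpa only [mul_one] using integral_sq_integral_mul hV (memLp_const 1)

lemma integrable_secondMoment (hV : MemLp (Function.uncurry V) 2 (P.prod μ)) {t : α}
    (ht : MemLp (fun ω => V ω t) 2 P) : Integrable (secondMoment P V t) μ :=
  ((ht.comp_fst μ).integrable_mul hV).integral_prod_right

lemma integrable_integral_secondMoment (hV : MemLp (Function.uncurry V) 2 (P.prod μ)) :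
    Integrable (fun t => ∫ s, secondMoment P V t s ∂μ) μ := by
  have hint := integrable_mul_mul_mul hV (memLp_const 1)
  simp only [mul_one] at hint
  exact hint.integral_prod_right.integral_prod_left

end FiniteMeasure

section ProbabilityMeasure

variable [SFinite P] [IsProbabilityMeasure μ]

lemma meanSq_center (hV : MemLp (Function.uncurry V) 2 (P.prod μ)) :
    meanSq P μ (center μ V) = meanSq P μ V - ∫ ω, (∫ t, V ω t ∂μ) ^ 2 ∂P := by
  simp only [meanSq, ← integral_sub (integrable_integral_sq hV) (memLp_integral hV).integrable_sq]
  refine integral_congr_ae ?_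
  filter_upwards [ae_memLp_of_memLp_uncurry hV] with ω hω
  have hvar := variance_eq_sub hω
  rwa [variance_eq_integral hω.1.aemeasurable] at hvar

lemma meanSq_center_le (hV : MemLp (Function.uncurry V) 2 (P.prod μ)) :
    meanSq P μ (center μ V) ≤ meanSq P μ V :=
  (meanSq_center hV).trans_le (sub_le_self _ (integral_nonneg fun _ => sq_nonneg _))

end ProbabilityMeasure

end SecondOrder

section Complexity

variable {Ω : Type*} [MeasurableSpace Ω] {P : Measure Ω} {d : ℕ} {V W : Ω → Cube d → ℝ}

lemma minError_add_smul_succ_le (hV : ∀ᵐ ω ∂P, MemLp (V ω) 2 volume) {g : Cube d → ℝ}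
    (hg : MemLp g 2 volume) {c : Ω → ℝ} (hW : ∀ ω, W ω = V ω + c ω • g) (n : ℕ) :
    minError P W (n + 1) ≤ minError P V n := by
  refine le_iInf fun ψ => ?_
  obtain ⟨φ, hφ⟩ := exists_norm_add_smul_sub_sum_le (𝕜 := ℝ) ψ (hg.toLp g)
  refine (iInf_le _ φ).trans (ENNReal.rpow_le_rpow (lintegral_mono_ae ?_) (by norm_num))
  filter_upwards [hV] with ω hω
  have hWω : MemLp (V ω + c ω • g) 2 volume := hω.add (hg.const_smul _)
  simp only [rankApprox, hW]
  rw [eLpNorm_sub_sum_integral_mul hWω, eLpNorm_sub_sum_integral_mul hω]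
  gcongr 1
  exact enorm_le_iff_norm_le.2 (hφ (hω.toLp _) (c ω))

lemma minError_succ_le (hV : ∀ᵐ ω ∂P, MemLp (V ω) 2 volume) (n : ℕ) :
    minError P V (n + 1) ≤ minError P V n :=
  minError_add_smul_succ_le hV MemLp.zero (c := 0) (fun ω => by simp) n

lemma admissibleRanks_mono {ε δ : ℝ} (h : ε ≤ δ) :
    admissibleRanks P V ε ⊆ admissibleRanks P V δ :=
  fun _ hn => ⟨hn.1, hn.2.trans (by gcongr)⟩

lemma complexity_anti {ε δ : ℝ} (hne : (admissibleRanks P V ε).Nonempty) (h : ε ≤ δ) :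
    complexity P V δ ≤ complexity P V ε :=
  Nat.sInf_le (admissibleRanks_mono h (Nat.sInf_mem hne))

lemma complexity_add_smul_le (hV : ∀ᵐ ω ∂P, MemLp (V ω) 2 volume) {g : Cube d → ℝ}
    (hg : MemLp g 2 volume) {c : Ω → ℝ} (hW : ∀ ω, W ω = V ω + c ω • g) {ε δ : ℝ}
    (hne : (admissibleRanks P V ε).Nonempty)
    (hle : ENNReal.ofReal ε * rms P V ≤ ENNReal.ofReal δ * rms P W) :
    complexity P W δ ≤ complexity P V ε + 1 :=
  Nat.sInf_le ⟨Nat.succ_pos _,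
    (minError_add_smul_succ_le hV hg hW _).trans ((Nat.sInf_mem hne).2.trans hle)⟩

variable [SFinite P]

lemma rms_eq_ofReal_sqrt_meanSq (hV : MemLp (Function.uncurry V) 2 (P.prod volume)) :
    rms P V = ENNReal.ofReal √(meanSq P volume V) := by
  rw [rms, lintegral_eLpNorm_sq hV, Real.sqrt_eq_rpow,
    ENNReal.ofReal_rpow_of_nonneg (meanSq_nonneg _ _ _) (by norm_num)]

lemma exists_minError_le (hV : MemLp (Function.uncurry V) 2 (P.prod volume)) {δ : ℝ} (hδ : 0 < δ) :
    ∃ n, minError P V n ≤ ENNReal.ofReal δ := by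
  obtain ⟨w, b, -⟩ := exists_hilbertBasis ℝ (Lp ℝ 2 (volume : Measure (Cube d)))
  have : MeasurableSpace.CountablyGenerated (Cube d) := countablyGenerated_of_standardBorel
  have hpartial := (hasSum_integral_sq_integral_mul hV b).eventually
    (lt_mem_nhds (sub_lt_self _ (pow_pos hδ 2)))
  obtain ⟨F, hF⟩ := hpartial.exists
  let ψ : Fin F.card → Lp ℝ 2 (volume : Measure (Cube d)) := fun m => b (F.equivFin.symm m)
  have hψ : Orthonormal ℝ ψ :=
    b.orthonormal.comp _ (Subtype.val_injective.comp F.equivFin.symm.injective)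
  have hsum : ∑ m, ∫ ω, (∫ t, V ω t * ψ m t) ^ 2 ∂P
      = ∑ i ∈ F, ∫ ω, (∫ t, V ω t * b i t) ^ 2 ∂P := by
    rw [← Finset.sum_coe_sort F]
    exact F.equivFin.symm.sum_comp fun i : F => ∫ ω, (∫ t, V ω t * b i t) ^ 2 ∂P
  refine ⟨F.card, (iInf_le _ ψ).trans ?_⟩
  calc rms P (fun ω t => V ω t - rankApprox V ψ ω t)
      = ENNReal.ofReal (meanSq P volume V - ∑ i ∈ F, ∫ ω, (∫ t, V ω t * b i t) ^ 2 ∂P)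
          ^ (1 / 2 : ℝ) := by
        simp only [rms, rankApprox]
        rw [lintegral_eLpNorm_sub_sum_sq hV hψ, hsum]
    _ ≤ ENNReal.ofReal (δ ^ 2) ^ (1 / 2 : ℝ) := by
        gcongr
        linarith
    _ = ENNReal.ofReal δ := by
        rw [ENNReal.ofReal_rpow_of_nonneg (by positivity) (by norm_num), ← Real.sqrt_eq_rpow,
          Real.sqrt_sq hδ.le]

lemma admissibleRanks_nonempty (hV : MemLp (Function.uncurry V) 2 (P.prod volume))
    (hpos : 0 < meanSq P volume V) {ε : ℝ} (hε : 0 < ε) : (admissibleRanks P V ε).Nonempty := by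
  obtain ⟨n, hn⟩ := exists_minError_le hV (mul_pos hε (Real.sqrt_pos.2 hpos))
  refine ⟨n + 1, n.succ_pos, (minError_succ_le (ae_memLp_of_memLp_uncurry hV) n).trans ?_⟩
  rwa [rms_eq_ofReal_sqrt_meanSq hV, ← ENNReal.ofReal_mul hε.le]

lemma ofReal_div_sqrt_mul_rms (hV : MemLp (Function.uncurry V) 2 (P.prod volume))
    (hW : MemLp (Function.uncurry W) 2 (P.prod volume)) (hpos : 0 < meanSq P volume W)
    {ε : ℝ} (hε : 0 ≤ ε) :
    ENNReal.ofReal (ε / √(meanSq P volume W / meanSq P volume V)) * rms P W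
      = ENNReal.ofReal ε * rms P V := by
  rw [rms_eq_ofReal_sqrt_meanSq hV, rms_eq_ofReal_sqrt_meanSq hW, Real.sqrt_div hpos.le,
    ← ENNReal.ofReal_mul (by positivity), ← ENNReal.ofReal_mul hε, div_div_eq_mul_div,
    div_mul_cancel₀ _ (Real.sqrt_pos.2 hpos).ne']

lemma complexity_center_le (hV : MemLp (Function.uncurry V) 2 (P.prod volume))
    (hpos : 0 < meanSq P volume (center volume V)) {ε : ℝ} (hε : 0 < ε) :
    complexity P (center volume V) (ε / √(meanSq P volume (center volume V) / meanSq P volume V))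
      ≤ complexity P V ε + 1 := by
  have hVpos := hpos.trans_le (meanSq_center_le hV)
  refine complexity_add_smul_le (ae_memLp_of_memLp_uncurry hV) (memLp_const 1)
    (c := fun ω => -∫ s, V ω s) (fun ω => ?_) (admissibleRanks_nonempty hV hVpos hε)
    (ofReal_div_sqrt_mul_rms hV (memLp_center hV) hpos hε.le).ge
  ext t
  simp [center, sub_eq_add_neg]

lemma complexity_le_center (hV : MemLp (Function.uncurry V) 2 (P.prod volume))
    (hpos : 0 < meanSq P volume (center volume V)) {ε : ℝ} (hε : 0 < ε) :
    complexity P V ε ≤ complexity P (center volume V)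
      (ε / √(meanSq P volume (center volume V) / meanSq P volume V)) + 1 := by
  have hVpos := hpos.trans_le (meanSq_center_le hV)
  have hZ := memLp_center hV
  refine complexity_add_smul_le (ae_memLp_of_memLp_uncurry hZ) (memLp_const 1)
    (c := fun ω => ∫ s, V ω s) (fun ω => ?_)
    (admissibleRanks_nonempty hZ hpos (div_pos hε (Real.sqrt_pos.2 (div_pos hpos hVpos))))
    (ofReal_div_sqrt_mul_rms hV hZ hpos hε.le).le
  ext t
  simp [center]

end Complexity

section Additive

variable {Ω : Type*} [MeasurableSpace Ω] {P : Measure Ω}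
  {X : ℕ → unitInterval → Ω → ℝ} {K : unitInterval → unitInterval → ℝ} {d : ℕ}

lemma trace_secondMoment [SFinite P] {V : Ω → unitInterval → ℝ}
    (hV : MemLp (Function.uncurry V) 2 (P.prod volume)) {ι : Type*}
    (e : HilbertBasis ι ℝ (Lp ℝ 2 (volume : Measure unitInterval))) :
    trace (secondMoment P V) e = ∫ s, secondMoment P V s s := by
  rw [← meanSq_eq_integral_secondMoment hV, ← (hasSum_integral_sq_integral_mul hV e).tsum_eq]
  exact tsum_congr fun i => (integral_sq_integral_mul hV (Lp.memLp (e i))).symm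

lemma integral_mul_eq_covariance [IsProbabilityMeasure P] {f g : Ω → ℝ} (hf : MemLp f 2 P)
    (hg : MemLp g 2 P) (hf0 : ∫ ω, f ω ∂P = 0) : ∫ ω, f ω * g ω ∂P = covariance f g P := by
  rw [covariance_eq_sub hf hg, hf0, zero_mul, sub_zero]
  rfl

lemma secondMoment_process [IsProbabilityMeasure P] (hL2 : ∀ j t, MemLp (X j t) 2 P)
    (hmean : ∀ j t, ∫ ω, X j t ω ∂P = 0) (hcov : ∀ j t s, covariance (X j t) (X j s) P = K t s)
    (j : ℕ) : secondMoment P (fun ω t => X j t ω) = K := by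
  ext t s
  rw [← hcov j, ← integral_mul_eq_covariance (hL2 j t) (hL2 j s) (hmean j t), secondMoment]

lemma memLp_fieldY [SFinite P]
    (hX : ∀ j, MemLp (Function.uncurry fun ω t => X j t ω) 2 (P.prod volume)) (d : ℕ) :
    MemLp (Function.uncurry (fieldY X d)) 2 (P.prod volume) :=
  memLp_finsetSum (f := fun (j : Fin d) (z : Ω × Cube d) => X j (z.2 j) z.1) Finset.univ fun j _ =>
    (hX j).comp_measurePreserving ((MeasurePreserving.id P).prod
      (measurePreserving_eval (fun _ : Fin d => (volume : Measure unitInterval)) j))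

lemma secondMoment_fieldY [IsProbabilityMeasure P] (hL2 : ∀ j t, MemLp (X j t) 2 P)
    (hmean : ∀ j t, ∫ ω, X j t ω ∂P = 0) (hcov : ∀ j t s, covariance (X j t) (X j s) P = K t s)
    (huncorr : ∀ j k, j ≠ k → ∀ t s, covariance (X j t) (X k s) P = 0) (t s : Cube d) :
    secondMoment P (fieldY X d) t s = ∑ j, K (t j) (s j) := by
  have hY : ∀ t : Cube d, MemLp (fun ω => fieldY X d ω t) 2 P := fun t =>
    memLp_finsetSum (f := fun (j : Fin d) ω => X j (t j) ω) _ fun j _ => hL2 j (t j)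
  have hY0 : ∫ ω, fieldY X d ω t ∂P = 0 :=
    (integral_finsetSum _ fun (j : Fin d) _ => (hL2 j (t j)).integrable one_le_two).trans
      (Finset.sum_eq_zero fun j _ => hmean j (t j))
  rw [secondMoment, integral_mul_eq_covariance (hY t) (hY s) hY0]
  simp only [fieldY]
  rw [covariance_fun_sum_fun_sum (fun j : Fin d => hL2 j (t j)) fun j : Fin d => hL2 j (s j)]
  refine Finset.sum_congr rfl fun j _ => ?_
  rw [Finset.sum_eq_single_of_mem j (Finset.mem_univ j) fun k _ hkj =>
    huncorr _ _ (Fin.val_ne_of_ne hkj.symm) _ _, hcov]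

lemma integral_sum_eval {κ : Type*} [Fintype κ] {E : κ → Type*} [∀ k, MeasurableSpace (E k)]
    {μ : ∀ k, Measure (E k)} [∀ k, IsProbabilityMeasure (μ k)] {f : ∀ k, E k → ℝ}
    (hf : ∀ k, Integrable (f k) (μ k)) :
    ∫ t, ∑ k, f k (t k) ∂Measure.pi μ = ∑ k, ∫ s, f k s ∂μ k := by
  rw [integral_finsetSum _ fun k _ => integrable_comp_eval (hf k)]
  exact Finset.sum_congr rfl fun k _ => integral_comp_eval (hf k).1

lemma integral_cube_sum_eval {f : unitInterval → ℝ} (hf : Integrable f) :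
    ∫ t : Cube d, ∑ j, f (t j) = d * ∫ s, f s := by
  rw [volume_pi, integral_sum_eval fun _ => hf, Finset.sum_const, Finset.card_univ,
    Fintype.card_fin, nsmul_eq_mul]

lemma meanSq_fieldY [SFinite P] (hdiag : Integrable fun t => K t t)
    (hY : MemLp (Function.uncurry (fieldY X d)) 2 (P.prod volume))
    (hYK : ∀ t s, secondMoment P (fieldY X d) t s = ∑ j, K (t j) (s j)) :
    meanSq P volume (fieldY X d) = d * ∫ s, K s s := by
  simp only [meanSq_eq_integral_secondMoment hY, hYK]
  exact integral_cube_sum_eval hdiag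

lemma meanSq_fieldZ [SFinite P] (hdiag : Integrable fun t => K t t)
    (hK : ∀ t, Integrable (K t)) (hKint : Integrable fun t => ∫ s, K t s)
    (hY : MemLp (Function.uncurry (fieldY X d)) 2 (P.prod volume))
    (hYK : ∀ t s, secondMoment P (fieldY X d) t s = ∑ j, K (t j) (s j)) :
    meanSq P volume (fieldZ X d) = d * traceBar K := by
  have hinner : ∀ t : Cube d, ∫ s : Cube d, ∑ j, K (t j) (s j) = ∑ j, ∫ s, K (t j) s :=
    fun t => integral_sum_eval fun j => hK (t j)
  calc meanSq P volume (fieldZ X d)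
      = meanSq P volume (fieldY X d) - ∫ ω, (∫ t, fieldY X d ω t) ^ 2 ∂P := meanSq_center hY
    _ = d * (∫ s, K s s) - d * ∫ t, ∫ s, K t s := by
        simp only [meanSq_fieldY hdiag hY hYK, integral_sq_integral hY, hYK, hinner]
        rw [integral_cube_sum_eval hKint]
    _ = d * traceBar K := (mul_sub _ _ _).symm

lemma traceBar_ne_zero_of_epsZero_pos {ι : Type*}
    {e : HilbertBasis ι ℝ (Lp ℝ 2 (volume : Measure unitInterval))} (h : 0 < epsZero K e) :
    traceBar K ≠ 0 :=
  fun h0 => h.ne' (by rw [epsZero, h0, zero_div, Real.sqrt_zero])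

lemma integrable_diag_of_continuous (hK : Continuous (Function.uncurry K)) :
    Integrable fun t => K t t :=
  (hK.comp (continuous_id.prodMk continuous_id)).integrable_of_hasCompactSupport
    (HasCompactSupport.of_compactSpace _)

end Additive

end AdditiveField

open AdditiveField in
theorem theorem1_general {Ω : Type*} [MeasurableSpace Ω] (P : Measure Ω) [IsProbabilityMeasure P]
    (X : ℕ → unitInterval → Ω → ℝ) (K : unitInterval → unitInterval → ℝ)
    (hdiag : Integrable fun t => K t t)
    (hmeas : ∀ j, AEStronglyMeasurable (fun p : Ω × unitInterval => X j p.2 p.1) (P.prod volume))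
    (hL2 : ∀ j t, MemLp (X j t) 2 P)
    (hmean : ∀ j t, ∫ ω, X j t ω ∂P = 0)
    (hcov : ∀ j t s, covariance (X j t) (X j s) P = K t s)
    (huncorr : ∀ j k, j ≠ k → ∀ t s, covariance (X j t) (X k s) P = 0)
    {ι : Type*} (e : HilbertBasis ι ℝ (Lp ℝ 2 (volume : Measure unitInterval)))
    (hbar : traceBar K ≠ 0) {ε : ℝ} (hε : 0 < ε) {d : ℕ} (hd : 1 ≤ d) :
    (admissibleRanks P (fieldY X d) ε).Nonempty ∧
    (admissibleRanks P (fieldZ X d) (ε / epsZero K e)).Nonempty ∧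
    complexity P (fieldZ X d) (ε / epsZero K e) ≤ complexity P (fieldY X d) ε + 1 ∧
    complexity P (fieldY X d) ε ≤ complexity P (fieldZ X d) (ε / epsZero K e) + 1 := by
  have hXK := secondMoment_process hL2 hmean hcov
  have hX : ∀ j, MemLp (Function.uncurry fun ω t => X j t ω) 2 (P.prod volume) := fun j =>
    memLp_uncurry_of_integrable_secondMoment (hmeas j) (hL2 j) (by rwa [hXK])
  have hY := memLp_fieldY hX d
  have hYK := secondMoment_fieldY hL2 hmean hcov huncorr (d := d)
  have hmY : meanSq P volume (fieldY X d) = d * trace K e := by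
    rw [meanSq_fieldY hdiag hY hYK, ← hXK 0, trace_secondMoment (hX 0)]
  have hmZ : meanSq P volume (center volume (fieldY X d)) = d * traceBar K :=
    meanSq_fieldZ hdiag (fun t => hXK 0 ▸ integrable_secondMoment (hX 0) (hL2 0 t))
      (hXK 0 ▸ integrable_integral_secondMoment (hX 0)) hY hYK
  have hd0 : (d : ℝ) ≠ 0 := Nat.cast_ne_zero.2 (Nat.one_le_iff_ne_zero.1 hd)
  have hZpos : 0 < meanSq P volume (center volume (fieldY X d)) :=
    (meanSq_nonneg _ _ _).lt_of_ne' (hmZ ▸ mul_ne_zero hd0 hbar)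
  have hYpos := hZpos.trans_le (meanSq_center_le hY)
  have hε₀ : epsZero K e
      = √(meanSq P volume (center volume (fieldY X d)) / meanSq P volume (fieldY X d)) := by
    rw [hmY, hmZ, mul_div_mul_left _ _ hd0, epsZero]
  rw [hε₀]
  exact ⟨admissibleRanks_nonempty hY hYpos hε, admissibleRanks_nonempty (memLp_center hY) hZpos
    (div_pos hε (Real.sqrt_pos.2 (div_pos hZpos hYpos))), complexity_center_le hY hZpos hε,
    complexity_le_center hY hZpos hε⟩

theorem theorem1 {Ω : Type*} [MeasurableSpace Ω] (P : Measure Ω) [IsProbabilityMeasure P]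
    (X : ℕ → unitInterval → Ω → ℝ) (K : unitInterval → unitInterval → ℝ)
    (hK : Continuous (Function.uncurry K))
    (hmeas : ∀ j, AEStronglyMeasurable (fun p : Ω × unitInterval => X j p.2 p.1) (P.prod volume))
    (hL2 : ∀ j t, MemLp (X j t) 2 P)
    (hmean : ∀ j t, ∫ ω, X j t ω ∂P = 0)
    (hcov : ∀ j t s, covariance (X j t) (X j s) P = K t s)
    (huncorr : ∀ j k, j ≠ k → ∀ t s, covariance (X j t) (X k s) P = 0)
    {ι : Type*} (e : HilbertBasis ι ℝ (Lp ℝ 2 (volume : Measure unitInterval)))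
    (ε : ℝ) (hε : 0 < ε) (hε' : ε < AdditiveField.epsZero K e) (d : ℕ) (hd : 1 ≤ d) :
    -- the minima that define the three complexities exist
    (AdditiveField.admissibleRanks P (AdditiveField.fieldZ X d)
        (ε / AdditiveField.epsZero K e + (d : ℝ) ^ (-(1 / 2) : ℝ))).Nonempty ∧
    (AdditiveField.admissibleRanks P (AdditiveField.fieldY X d) ε).Nonempty ∧
    (AdditiveField.admissibleRanks P (AdditiveField.fieldZ X d)
        (ε / AdditiveField.epsZero K e)).Nonempty ∧
    ((AdditiveField.complexity P (AdditiveField.fieldZ X d)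
        (ε / AdditiveField.epsZero K e + (d : ℝ) ^ (-(1 / 2) : ℝ)) : ℤ) - 1
      ≤ AdditiveField.complexity P (AdditiveField.fieldY X d) ε) ∧
    (AdditiveField.complexity P (AdditiveField.fieldY X d) ε
      ≤ AdditiveField.complexity P (AdditiveField.fieldZ X d)
          (ε / AdditiveField.epsZero K e) + 1) := by
  obtain ⟨hneY, hneZ, hZY, hYZ⟩ := theorem1_general P X K
    (AdditiveField.integrable_diag_of_continuous hK) hmeas hL2 hmean hcov huncorr e
    (AdditiveField.traceBar_ne_zero_of_epsZero_pos (hε.trans hε')) hε hd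
  have hle : ε / AdditiveField.epsZero K e
      ≤ ε / AdditiveField.epsZero K e + (d : ℝ) ^ (-(1 / 2) : ℝ) :=
    le_add_of_nonneg_right (Real.rpow_nonneg d.cast_nonneg _)
  have hanti := AdditiveField.complexity_anti hneZ hle
  exact ⟨hneZ.mono (AdditiveField.admissibleRanks_mono hle), hneY, hneZ, by omega, hYZ⟩
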